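/- Let $R$ be an associative ring with identity. A right coprime pair in $R$ is a pair $(a,b)\in R^2$ with $aR+bR=R$. Two right coprime pairs $(a,b)$ and $(a',b')$ are identified when $aR=a'R$ and $bR=b'R$; write $\langle a,b\rangle$ for the class of $(a,b)$, call any pair in the class a pair of generators of it, and let $\operatorname{RCP}(R)$ be the set of classes, partially ordered by $$\langle a,b\rangle\le\langle a',b'\rangle \iff aR\subseteq a'R \text{ and } bR\subseteq b'R.$$ A compatible descending chain of right coprime pairs is a family $(p_\alpha)_{\alpha<\kappa}$ in $\operatorname{RCP}(R)$ indexed by an ordinal $\kappa$, with $p_\beta\le p_\alpha$ for all $\alpha\le\beta<\kappa$, for which there are pairs of generators $(a_\alpha,b_\alpha)$ of $p_\alpha$ $(\alpha<\kappa)$ and elements $r_{\alpha\beta},s_{\alpha\beta}\in R$ $(\alpha<\beta<\kappa)$ such that 1. $a_\beta=a_\alpha r_{\alpha\beta}$ and $b_\beta=b_\alpha s_{\alpha\beta}$ for all $\alpha<\beta<\kappa$; 2. $r_{\alpha\beta}=r_{\alpha\gamma}r_{\gamma\beta}$ and $s_{\alpha\beta}=s_{\alpha\gamma}s_{\gamma\beta}$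 for all $\alpha<\gamma<\beta<\kappa$. The ring $R$ is right strongly exchange if for every compatible descending chain $(p_\alpha)_{\alpha<\kappa}$ of right coprime pairs there is a minimal element $m$ of $\operatorname{RCP}(R)$ with $m\le p_\alpha$ for all $\alpha<\kappa$. The ring $R$ is left cotorsion if $\operatorname{Ext}^1_R(F,R)=0$ for every flat left $R$-module $F$. **Theorem.** Every left cotorsion ring is right strongly exchange. -/

import Mathlib

open scoped TensorProduct

universe u v w

namespace CoprimeChain

/-! ### Right coprime pairs -/

/-- The principal right ideal `aR`, as a submodule of the right `R`-module `R`
(right modules are modules over `Rᵐᵒᵖ`). -/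
def rightIdeal {R : Type u} [Ring R] (a : R) : Submodule Rᵐᵒᵖ R :=
  Submodule.span Rᵐᵒᵖ {a}

theorem mem_rightIdeal {R : Type u} [Ring R] {a x : R} :
    x ∈ rightIdeal a ↔ ∃ r : R, a * r = x := by
  unfold rightIdeal
  rw [Submodule.mem_span_singleton]
  constructor
  · rintro ⟨r, rfl⟩
    exact ⟨r.unop, rfl⟩
  · rintro ⟨r, rfl⟩
    exact ⟨MulOpposite.op r, rfl⟩

/-- A pair of elements `(fst, snd)` of `R` with `fst R + snd R = R`. -/
@[ext]
structure CoprimePair (R : Type u) [Ring R] where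
  fst : R
  snd : R
  coprime : rightIdeal fst ⊔ rightIdeal snd = ⊤

/-- `(a, b) ≤ (a', b')` if and only if `aR ⊆ a'R` and `bR ⊆ b'R`. -/
instance (R : Type u) [Ring R] : Preorder (CoprimePair R) where
  le p q := rightIdeal p.fst ≤ rightIdeal q.fst ∧ rightIdeal p.snd ≤ rightIdeal q.snd
  le_refl _ := ⟨le_rfl, le_rfl⟩
  le_trans _ _ _ h₁ h₂ := ⟨h₁.1.trans h₂.1, h₁.2.trans h₂.2⟩

/-- `RCP(R)`: the classes of right coprime pairs modulo `(a, b) ∼ (a', b')` if and only if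
`aR = a'R` and `bR = b'R`, with the partial order induced by the preorder above. -/
abbrev RCP (R : Type u) [Ring R] : Type u :=
  Antisymmetrization (CoprimePair R) (· ≤ ·)

/-- The class `⟨a, b⟩` of a right coprime pair. -/
def CoprimePair.cls {R : Type u} [Ring R] (p : CoprimePair R) : RCP R :=
  toAntisymmetrization (· ≤ ·) p

theorem CoprimePair.cls_eq_iff {R : Type u} [Ring R] {p q : CoprimePair R} :
    p.cls = q.cls ↔
      rightIdeal p.fst = rightIdeal q.fst ∧ rightIdeal p.snd = rightIdeal q.snd := by
  refine Quotient.eq.trans ?_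
  constructor
  · rintro ⟨h₁, h₂⟩
    exact ⟨le_antisymm h₁.1 h₂.1, le_antisymm h₁.2 h₂.2⟩
  · rintro ⟨h₁, h₂⟩
    exact ⟨⟨h₁.le, h₂.le⟩, ⟨h₁.ge, h₂.ge⟩⟩

theorem CoprimePair.cls_le_iff {R : Type u} [Ring R] {p q : CoprimePair R} :
    p.cls ≤ q.cls ↔
      rightIdeal p.fst ≤ rightIdeal q.fst ∧ rightIdeal p.snd ≤ rightIdeal q.snd :=
  Iff.rfl

/-! ### Compatible descending chains and right strongly exchange rings -/

/-- A compatible descending chain `{p α ∣ α < κ}` of right coprime pairs: there are pairs of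
generators `(a α, b α)` of the `p α` and scalars `r α β`, `s α β` for `α < β` with
`a β = a α * r α β`, `b β = b α * s α β`, and `r α β = r α γ * r γ β`, `s α β = s α γ * s γ β`
for `α < γ < β`. (The values of `r` and `s` off `α < β` are irrelevant.) -/
def IsCompatibleChain {R : Type u} [Ring R] {κ : Ordinal.{u}} (p : Set.Iio κ → RCP R) : Prop :=
  Antitone p ∧
  ∃ (g : Set.Iio κ → CoprimePair R) (r s : Set.Iio κ → Set.Iio κ → R),
    (∀ α, (g α).cls = p α) ∧
    (∀ α β, α < β → (g β).fst = (g α).fst * r α β ∧ (g β).snd = (g α).snd * s α β) ∧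
    (∀ α γ β, α < γ → γ < β → r α β = r α γ * r γ β ∧ s α β = s α γ * s γ β)

/-- `R` is right strongly exchange if every compatible descending chain of right coprime pairs
has a lower bound in `RCP(R)` that is a minimal element of `RCP(R)`. -/
def IsRightStronglyExchange (R : Type u) [Ring R] : Prop :=
  ∀ (κ : Ordinal.{u}) (p : Set.Iio κ → RCP R), IsCompatibleChain p →
    ∃ m : RCP R, (∀ α, m ≤ p α) ∧ IsMin m

/-! ### Flat left modules over a not necessarily commutative ring -/

/-- The relations `m r ⊗ f = m ⊗ r f` in `M ⊗_ℤ F`. -/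
def balancedRelations (R : Type u) [Ring R] (M : Type v) [AddCommGroup M] [Module Rᵐᵒᵖ M]
    (F : Type w) [AddCommGroup F] [Module R F] : AddSubgroup (M ⊗[ℤ] F) :=
  AddSubgroup.closure
    {t | ∃ (m : M) (r : R) (f : F), t = (MulOpposite.op r • m) ⊗ₜ[ℤ] f - m ⊗ₜ[ℤ] (r • f)}

/-- The tensor product `M ⊗_R F` (an abelian group) of a right `R`-module `M` and a left
`R`-module `F`. -/
abbrev BalancedTensor (R : Type u) [Ring R] (M : Type v) [AddCommGroup M] [Module Rᵐᵒᵖ M]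
    (F : Type w) [AddCommGroup F] [Module R F] : Type (max v w) :=
  (M ⊗[ℤ] F) ⧸ balancedRelations R M F

/-- The additive map `φ ⊗ F : M ⊗_R F → N ⊗_R F` induced by a homomorphism `φ : M → N` of right
`R`-modules. -/
def BalancedTensor.map {R : Type u} [Ring R] {M N : Type v} [AddCommGroup M] [Module Rᵐᵒᵖ M]
    [AddCommGroup N] [Module Rᵐᵒᵖ N] (F : Type w) [AddCommGroup F] [Module R F]
    (φ : M →ₗ[Rᵐᵒᵖ] N) : BalancedTensor R M F →+ BalancedTensor R N F :=
  QuotientAddGroup.map (balancedRelations R M F) (balancedRelations R N F)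
    (LinearMap.rTensor F φ.toAddMonoidHom.toIntLinearMap).toAddMonoidHom (by
      unfold balancedRelations
      rw [AddSubgroup.closure_le]
      rintro _ ⟨m, r, f, rfl⟩
      refine AddSubgroup.subset_closure ⟨φ m, r, f, ?_⟩
      simp)

/-- A left `R`-module `F` is flat if `- ⊗_R F` preserves injectivity of homomorphisms of right
`R`-modules (in the universe of `R`, which contains all right ideals of `R`). -/
def IsFlat (R : Type u) [Ring R] (F : Type w) [AddCommGroup F] [Module R F] : Prop :=
  ∀ (M N : Type u) [AddCommGroup M] [Module Rᵐᵒᵖ M] [AddCommGroup N] [Module Rᵐᵒᵖ N]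
    (φ : M →ₗ[Rᵐᵒᵖ] N), Function.Injective φ → Function.Injective (BalancedTensor.map F φ)

/-! ### Left cotorsion rings -/

/-- `R` is left cotorsion if `Ext¹_R(F, R) = 0` for every flat left `R`-module `F`. -/
def IsLeftCotorsion (R : Type u) [Ring R] : Prop :=
  ∀ F : ModuleCat.{u} R, IsFlat R F →
    Subsingleton (CategoryTheory.Abelian.Ext.{u} F (ModuleCat.of R R) 1)

end CoprimeChain

namespace CoprimeChain

open CategoryTheory
open MulOpposite (op op_mul op_one op_zero)

/-! Take a directed system of right coprime pairs (a_i, b_i) with compatible scalars r_ij, s_ij.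
Right multiplication by these scalars makes copies of R² a direct system of left modules, and the
maps u ↦ (u a_i, u b_i) embed R in its limit. At each stage an equation a_i x + b_i y = 1 splits the
embedding, so the cokernel in the limit is a direct limit of projectives, hence flat
(`isFlat_cokernel`). Over a left cotorsion ring the embedding into the limit therefore has a
retraction h. If x_i, y_i are its values on the germs of (1, 0) and (0, 1) at i, then a_i x_i + b_i
y_i = 1 and neither summand depends on i. The two summands form a coprime pair below the whole
system (`CoprimeSystem.exists_cone`).

This bounds a chain from below; a minimal pair below the bound comes from Zorn's lemma
(`IsLeftCotorsion.exists_isMin_le`). Inclusions of ideals do not determine the scalars, so Zorn is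
applied to totally preordered systems that carry them. A cone m over a maximal system is minimal: if
m' ≤ m, the cone composes to one with vertex m', so m' already lies in the system by maximality, and
m ≤ m'. -/

theorem CoprimePair.exists_mul_add_mul_eq_one {R : Type u} [Ring R] (p : CoprimePair R) :
    ∃ x y : R, p.fst * x + p.snd * y = 1 := by
  have h : (1 : R) ∈ rightIdeal p.fst ⊔ rightIdeal p.snd := p.coprime ▸ Submodule.mem_top
  obtain ⟨a, ha, b, hb, hab⟩ := Submodule.mem_sup.mp h
  obtain ⟨x, rfl⟩ := mem_rightIdeal.mp ha
  obtain ⟨y, rfl⟩ := mem_rightIdeal.mp hb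
  exact ⟨x, y, hab⟩

/-- The pair `(a, b)` is right coprime as soon as `a + b = 1`. -/
def CoprimePair.ofAddEqOne {R : Type u} [Ring R] (a b : R) (h : a + b = 1) : CoprimePair R where
  fst := a
  snd := b
  coprime := by
    refine Submodule.eq_top_iff'.mpr fun z => Submodule.mem_sup.mpr
      ⟨a * z, mem_rightIdeal.mpr ⟨z, rfl⟩, b * z, mem_rightIdeal.mpr ⟨z, rfl⟩, ?_⟩
    rw [← add_mul, h, one_mul]

theorem rightIdeal_le_iff {R : Type u} [Ring R] {a b : R} :
    rightIdeal a ≤ rightIdeal b ↔ ∃ x, a = b * x := by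
  constructor
  · intro h
    obtain ⟨x, hx⟩ := mem_rightIdeal.mp (h (mem_rightIdeal.mpr ⟨1, mul_one a⟩))
    exact ⟨x, hx.symm⟩
  · rintro ⟨x, rfl⟩ z hz
    obtain ⟨y, rfl⟩ := mem_rightIdeal.mp hz
    exact mem_rightIdeal.mpr ⟨x * y, (mul_assoc _ _ _).symm⟩

theorem CoprimePair.le_iff {R : Type u} [Ring R] {p q : CoprimePair R} :
    p ≤ q ↔ ∃ x y, p.fst = q.fst * x ∧ p.snd = q.snd * y := by
  refine (and_congr rightIdeal_le_iff rightIdeal_le_iff).trans ?_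
  simp

/-- A preordered system of right coprime pairs with compatible transition scalars. -/
structure CoprimeSystem (R : Type u) [Ring R] (ι : Type u) [Preorder ι] where
  pair : ι → CoprimePair R
  r : ι → ι → R
  s : ι → ι → R
  r_self : ∀ i, r i i = 1
  s_self : ∀ i, s i i = 1
  fst_eq : ∀ {i j}, i ≤ j → (pair j).fst = (pair i).fst * r i j
  snd_eq : ∀ {i j}, i ≤ j → (pair j).snd = (pair i).snd * s i j
  r_trans : ∀ {i j k}, i ≤ j → j ≤ k → r i k = r i j * r j k
  s_trans : ∀ {i j k}, i ≤ j → j ≤ k → s i k = s i j * s j k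

/-! ### The direct limit, with R embedded diagonally -/

namespace CoprimeSystem

variable {R : Type u} [Ring R] {ι : Type u} [Preorder ι] [IsDirectedOrder ι] [Nonempty ι]
  (S : CoprimeSystem R ι)

/-- The functions `ι → R × R` that eventually agree with `j ↦ (u * r i j, v * s i j)` for some
`i`, `u`, `v`. Modulo eventually zero functions they form the direct limit of the two systems
given by right multiplication with the transition scalars. -/
def eventuallyCompatible : Submodule R (ι → R × R) where
  carrier := {h | ∃ (i : ι) (u v : R), ∀ j, i ≤ j → h j = (u * S.r i j, v * S.s i j)}
  zero_mem' := ⟨Classical.arbitrary ι, 0, 0, fun j _ => by simp [Prod.zero_eq_mk]⟩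
  add_mem' := by
    rintro h h' ⟨i, u, v, hi⟩ ⟨i', u', v', hi'⟩
    obtain ⟨k, hk, hk'⟩ := exists_ge_ge i i'
    refine ⟨k, u * S.r i k + u' * S.r i' k, v * S.s i k + v' * S.s i' k, fun j hj => ?_⟩
    rw [Pi.add_apply, hi j (hk.trans hj), hi' j (hk'.trans hj), S.r_trans hk hj,
      S.r_trans hk' hj, S.s_trans hk hj, S.s_trans hk' hj]
    simp only [Prod.mk_add_mk, add_mul, mul_assoc]
  smul_mem' := by
    rintro c h ⟨i, u, v, hi⟩
    refine ⟨i, c * u, c * v, fun j hj => ?_⟩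
    rw [Pi.smul_apply, hi j hj]
    simp only [Prod.smul_mk, smul_eq_mul, mul_assoc]

/-- The element of the direct limit represented by `(u, v)` at the index `i`. -/
def germ (i : ι) (u v : R) : S.eventuallyCompatible :=
  ⟨fun j => (u * S.r i j, v * S.s i j), i, u, v, fun _ _ => rfl⟩

/-- The multiples of the system of pairs itself. -/
def diagonal : R →ₗ[R] S.eventuallyCompatible where
  toFun u := ⟨fun j => (u * (S.pair j).fst, u * (S.pair j).snd), Classical.arbitrary ι,
    u * (S.pair (Classical.arbitrary ι)).fst, u * (S.pair (Classical.arbitrary ι)).snd,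
    fun j hj => by
      simp only [S.fst_eq hj, S.snd_eq hj, mul_assoc]⟩
  map_add' u v := by ext j <;> simp [add_mul]
  map_smul' c u := by ext j <;> simp [mul_assoc]

/-- The eventually zero functions. -/
def eventuallyZero : Submodule R S.eventuallyCompatible where
  carrier := {h | ∃ i : ι, ∀ j, i ≤ j → h.1 j = 0}
  zero_mem' := ⟨Classical.arbitrary ι, fun _ _ => rfl⟩
  add_mem' := by
    rintro h h' ⟨i, hi⟩ ⟨i', hi'⟩
    obtain ⟨k, hk, hk'⟩ := exists_ge_ge i i'
    refine ⟨k, fun j hj => ?_⟩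
    change h.1 j + h'.1 j = 0
    rw [hi j (hk.trans hj), hi' j (hk'.trans hj), add_zero]
  smul_mem' := by
    rintro c h ⟨i, hi⟩
    refine ⟨i, fun j hj => ?_⟩
    change c • h.1 j = 0
    rw [hi j hj, smul_zero]

/-- The functions that eventually agree with a multiple of the system of pairs. -/
def eventuallyDiagonal : Submodule R S.eventuallyCompatible :=
  S.eventuallyZero ⊔ LinearMap.range S.diagonal

theorem exists_of_mem_eventuallyDiagonal {h : S.eventuallyCompatible}
    (hh : h ∈ S.eventuallyDiagonal) :
    ∃ (i : ι) (u : R), ∀ j, i ≤ j → h.1 j = (u * (S.pair j).fst, u * (S.pair j).snd) := by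
  obtain ⟨z, ⟨i, hi⟩, _, ⟨u, rfl⟩, rfl⟩ := Submodule.mem_sup.mp hh
  refine ⟨i, u, fun j hj => ?_⟩
  change z.1 j + _ = _
  rw [hi j hj, zero_add]
  rfl

theorem mem_eventuallyDiagonal {h : S.eventuallyCompatible} {i : ι} {u : R}
    (hh : ∀ j, i ≤ j → h.1 j = (u * (S.pair j).fst, u * (S.pair j).snd)) :
    h ∈ S.eventuallyDiagonal := by
  rw [← sub_add_cancel h (S.diagonal u)]
  refine add_mem (Submodule.mem_sup_left ⟨i, fun j hj => ?_⟩)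
    (Submodule.mem_sup_right ⟨u, rfl⟩)
  change h.1 j - _ = 0
  rw [hh j hj]
  exact sub_self (u * (S.pair j).fst, u * (S.pair j).snd)

/-- Injectivity of R into the limit: u = u (a_i x + b_i y) for a single index i. -/
theorem diagonal_mem_eventuallyZero {u : R} (h : S.diagonal u ∈ S.eventuallyZero) : u = 0 := by
  obtain ⟨i, hi⟩ := h
  obtain ⟨x, y, hxy⟩ := (S.pair i).exists_mul_add_mul_eq_one
  have h₀ := hi i le_rfl
  have h₁ : u * (S.pair i).fst = 0 := congrArg Prod.fst h₀
  have h₂ : u * (S.pair i).snd = 0 := congrArg Prod.snd h₀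
  rw [← mul_one u, ← hxy, mul_add, ← mul_assoc, ← mul_assoc, h₁, h₂, zero_mul, zero_mul,
    add_zero]

/-- The cokernel of the diagonal in the direct limit. -/
abbrev Cokernel : Type u := S.eventuallyCompatible ⧸ S.eventuallyDiagonal

/-! ### Evaluation maps detecting zero in N ⊗ `Cokernel` -/

section Evaluation

variable (N : Type u) [AddCommGroup N] [Module Rᵐᵒᵖ N]

/-- The functions `ι → N × N` that are eventually of the form `j ↦ (n a_j, n b_j)`. -/
def moduleDiagonal : AddSubgroup (ι → N × N) where
  carrier := {h | ∃ (i : ι) (n : N), ∀ j, i ≤ j →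
    h j = (op (S.pair j).fst • n, op (S.pair j).snd • n)}
  zero_mem' := ⟨Classical.arbitrary ι, 0, fun _ _ => by simp [Prod.zero_eq_mk]⟩
  add_mem' := by
    rintro h h' ⟨i, n, hi⟩ ⟨i', n', hi'⟩
    obtain ⟨k, hk, hk'⟩ := exists_ge_ge i i'
    refine ⟨k, n + n', fun j hj => ?_⟩
    rw [Pi.add_apply, hi j (hk.trans hj), hi' j (hk'.trans hj)]
    simp only [Prod.mk_add_mk, smul_add]
  neg_mem' := by
    rintro h ⟨i, n, hi⟩
    refine ⟨i, -n, fun j hj => ?_⟩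
    rw [Pi.neg_apply, hi j hj]
    simp only [Prod.neg_mk, smul_neg]

/-- Evaluation of a compatible function at an element of `N`. -/
def evalAux (n : N) : S.eventuallyCompatible →+ (ι → N × N) where
  toFun h j := (op (h.1 j).1 • n, op (h.1 j).2 • n)
  map_zero' := by ext j <;> simp
  map_add' h h' := by ext j <;> simp [add_smul]

/-- Evaluation on the cokernel of the diagonal at an element of `N`. -/
def evalCokernel (n : N) : S.Cokernel →+ (ι → N × N) ⧸ S.moduleDiagonal N :=
  QuotientAddGroup.map S.eventuallyDiagonal.toAddSubgroup (S.moduleDiagonal N)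
    (S.evalAux N n) (by
      intro h hh
      obtain ⟨i, u, hi⟩ := S.exists_of_mem_eventuallyDiagonal hh
      refine ⟨i, op u • n, fun j hj => ?_⟩
      change (op (h.1 j).1 • n, op (h.1 j).2 • n) = _
      rw [hi j hj, smul_smul, smul_smul]
      rfl)

theorem evalCokernel_mk (n : N) (h : S.eventuallyCompatible) :
    S.evalCokernel N n (Submodule.Quotient.mk h) =
      QuotientAddGroup.mk (s := S.moduleDiagonal N) (S.evalAux N n h) :=
  rfl

/-- The evaluation map on `N ⊗_ℤ Cokernel`. -/
def evalTensor : N ⊗[ℤ] S.Cokernel →+ (ι → N × N) ⧸ S.moduleDiagonal N :=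
  TensorProduct.liftAddHom
    (AddMonoidHom.mk' (S.evalCokernel N) fun n n' => by
      ext x
      obtain ⟨h, rfl⟩ := Submodule.Quotient.mk_surjective _ x
      simp only [AddMonoidHom.add_apply, evalCokernel_mk, ← QuotientAddGroup.mk_add]
      congr 1
      ext j <;> simp [evalAux])
    fun z n x => by
      rw [map_zsmul, map_zsmul]
      rfl

/-- The evaluation map on `N ⊗_R Cokernel`. -/
def evalBalanced :
    BalancedTensor R N S.Cokernel →+ (ι → N × N) ⧸ S.moduleDiagonal N :=
  QuotientAddGroup.lift _ (S.evalTensor N) (by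
    unfold balancedRelations
    rw [AddSubgroup.closure_le]
    rintro _ ⟨n, r, x, rfl⟩
    obtain ⟨h, rfl⟩ := Submodule.Quotient.mk_surjective _ x
    rw [SetLike.mem_coe, AddMonoidHom.mem_ker, map_sub, sub_eq_zero]
    rw [← Submodule.Quotient.mk_smul]
    change S.evalCokernel N (op r • n) (Submodule.Quotient.mk h) = S.evalCokernel N n (Submodule.Quotient.mk (r • h))
    rw [evalCokernel_mk, evalCokernel_mk]
    congr 1
    ext j <;> simp [evalAux, smul_smul])

end Evaluation

/-! ### Flatness of the cokernel -/

section Flat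

variable {N : Type u} [AddCommGroup N] [Module Rᵐᵒᵖ N]

/-- The class of a pure tensor in `N ⊗_R Cokernel`. -/
def tmul (n : N) (h : S.eventuallyCompatible) : BalancedTensor R N S.Cokernel :=
  QuotientAddGroup.mk (n ⊗ₜ[ℤ] Submodule.Quotient.mk h)

theorem tmul_add (n : N) (h h' : S.eventuallyCompatible) :
    S.tmul n (h + h') = S.tmul n h + S.tmul n h' := by
  unfold tmul
  rw [Submodule.Quotient.mk_add, TensorProduct.tmul_add, QuotientAddGroup.mk_add]

theorem add_tmul (n n' : N) (h : S.eventuallyCompatible) :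
    S.tmul (n + n') h = S.tmul n h + S.tmul n' h := by
  unfold tmul
  rw [TensorProduct.add_tmul, QuotientAddGroup.mk_add]

theorem smul_tmul (n : N) (c : R) (h : S.eventuallyCompatible) :
    S.tmul (op c • n) h = S.tmul n (c • h) := by
  refine (QuotientAddGroup.eq_iff_sub_mem).mpr (AddSubgroup.subset_closure ⟨n, c, _, rfl⟩)

theorem tmul_eq_of_sub_mem (n : N) {h h' : S.eventuallyCompatible}
    (hh : h - h' ∈ S.eventuallyDiagonal) : S.tmul n h = S.tmul n h' := by
  unfold tmul
  rw [(Submodule.Quotient.eq _).mpr hh]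

/-- The element of `N ⊗_R Cokernel` represented by `(n, n')` at the index `i`. -/
def tensorGerm (i : ι) (n n' : N) : BalancedTensor R N S.Cokernel :=
  S.tmul n (S.germ i 1 0) + S.tmul n' (S.germ i 0 1)

theorem tensorGerm_add (i : ι) (m m' n n' : N) :
    S.tensorGerm i (m + n) (m' + n') = S.tensorGerm i m m' + S.tensorGerm i n n' := by
  simp only [tensorGerm, add_tmul]
  abel

theorem tensorGerm_smul (i : ι) (n : N) (u v : R) :
    S.tensorGerm i (op u • n) (op v • n) = S.tmul n (S.germ i u v) := by
  rw [tensorGerm, smul_tmul, smul_tmul, ← tmul_add]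
  congr 1
  ext j <;> simp [germ]

theorem tensorGerm_eq (n n' : N) {i j : ι} (hij : i ≤ j) :
    S.tensorGerm i n n' = S.tensorGerm j (op (S.r i j) • n) (op (S.s i j) • n') := by
  rw [tensorGerm, tensorGerm, smul_tmul, smul_tmul]
  congr 1 <;> refine S.tmul_eq_of_sub_mem _ (Submodule.mem_sup_left ⟨j, fun k hk => ?_⟩)
  · simp [germ, S.r_trans hij hk]
  · simp [germ, S.s_trans hij hk]

/-- Tensoring commutes with direct limits: directedness lets a finite sum of tensors be moved to one
common index. -/
theorem exists_tensorGerm (t : BalancedTensor R N S.Cokernel) :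
    ∃ (i : ι) (n n' : N), t = S.tensorGerm i n n' := by
  obtain ⟨t, rfl⟩ := QuotientAddGroup.mk_surjective t
  induction t with
  | zero => exact ⟨Classical.arbitrary ι, 0, 0, by
      simp only [tensorGerm, tmul, TensorProduct.zero_tmul, QuotientAddGroup.mk_zero, add_zero]⟩
  | tmul n x =>
    obtain ⟨h, rfl⟩ := Submodule.Quotient.mk_surjective _ x
    obtain ⟨i, u, v, hi⟩ := h.2
    refine ⟨i, op u • n, op v • n, ?_⟩
    rw [tensorGerm_smul]
    refine S.tmul_eq_of_sub_mem n (Submodule.mem_sup_left ⟨i, fun j hj => ?_⟩)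
    change h.1 j - _ = 0
    rw [hi j hj]
    exact sub_self _
  | add t t' ht ht' =>
    obtain ⟨i, m, n, hi⟩ := ht
    obtain ⟨i', m', n', hi'⟩ := ht'
    obtain ⟨k, hk, hk'⟩ := exists_ge_ge i i'
    refine ⟨k, op (S.r i k) • m + op (S.r i' k) • m', op (S.s i k) • n + op (S.s i' k) • n', ?_⟩
    rw [QuotientAddGroup.mk_add, hi, hi', S.tensorGerm_eq _ _ hk, S.tensorGerm_eq _ _ hk',
      ← tensorGerm_add]

/-- Evaluation sends the germ to j ↦ (n r_ij, n' s_ij). Vanishing in the target quotient means that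
this is eventually of the form (c a_j, c b_j). -/
theorem exists_of_tensorGerm_eq_zero {i : ι} {n n' : N} (h : S.tensorGerm i n n' = 0) :
    ∃ j, i ≤ j ∧ ∃ c : N, op (S.r i j) • n = op (S.pair j).fst • c ∧
      op (S.s i j) • n' = op (S.pair j).snd • c := by
  have h₀ : QuotientAddGroup.mk (s := S.moduleDiagonal N)
      (S.evalAux N n (S.germ i 1 0) + S.evalAux N n' (S.germ i 0 1)) = 0 :=
    (congrArg (S.evalBalanced N) h).trans (map_zero _)
  obtain ⟨k, c, hk⟩ := (QuotientAddGroup.eq_zero_iff _).mp h₀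
  obtain ⟨j, hij, hkj⟩ := exists_ge_ge i k
  have := hk j hkj
  simp only [evalAux, germ, AddMonoidHom.coe_mk, ZeroHom.coe_mk, Pi.add_apply, one_mul,
    zero_mul, op_zero, zero_smul, Prod.mk_add_mk, add_zero, zero_add, Prod.mk.injEq] at this
  exact ⟨j, hij, c, this⟩

/-- An element killed by φ becomes (c a_j, c b_j) over N at some stage j. The splitting recovers c =
c a_j x + c b_j y from the two coordinates, so c comes from M, and the element is already diagonal
over M. -/
theorem isFlat_cokernel : IsFlat R S.Cokernel := by
  intro M N _ _ _ _ φ hφ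
  rw [injective_iff_map_eq_zero]
  intro t ht
  obtain ⟨i, m, m', rfl⟩ := S.exists_tensorGerm t
  obtain ⟨j, hij, c, h₁, h₂⟩ :=
    S.exists_of_tensorGerm_eq_zero (show S.tensorGerm i (φ m) (φ m') = 0 from ht)
  obtain ⟨x, y, hxy⟩ := (S.pair j).exists_mul_add_mul_eq_one
  set d : M := op x • op (S.r i j) • m + op y • op (S.s i j) • m' with hd
  have hc : φ d = c := by
    rw [hd, map_add, map_smul, map_smul, map_smul, map_smul, h₁, h₂, smul_smul, smul_smul,
      ← add_smul, ← op_mul, ← op_mul, ← MulOpposite.op_add, hxy, op_one, one_smul]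
  rw [← hc, ← map_smul, ← map_smul] at h₁ h₂
  rw [S.tensorGerm_eq _ _ hij, hφ h₁, hφ h₂, tensorGerm_smul, tmul,
    (Submodule.Quotient.mk_eq_zero _).mpr, TensorProduct.tmul_zero, QuotientAddGroup.mk_zero]
  -- The remaining tensor is d ⊗ germ of (a_j, b_j), and that germ is eventually the diagonal of 1.
  refine S.mem_eventuallyDiagonal (i := j) (u := 1) fun k hk => ?_
  rw [one_mul, one_mul, S.fst_eq hk, S.snd_eq hk]
  rfl

end Flat

end CoprimeSystem

/-! ### Retractions and cones over left cotorsion rings -/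

/-- The obstruction to extending the identity of R along f lies in Ext¹(K, R), which vanishes. -/
theorem IsLeftCotorsion.exists_retraction {R : Type u} [Ring R] (hR : IsLeftCotorsion R)
    {M K : Type u} [AddCommGroup M] [Module R M] [AddCommGroup K] [Module R K]
    (f : R →ₗ[R] M) (g : M →ₗ[R] K) (hf : Function.Injective f) (hg : Function.Surjective g)
    (hfg : Function.Exact f g) (hK : IsFlat R K) : ∃ h : M →ₗ[R] R, ∀ x, h (f x) = x := by
  let S : ShortComplex (ModuleCat.{u} R) :=
    ShortComplex.moduleCatMk f g hfg.linearMap_comp_eq_zero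
  have hS : S.ShortExact :=
    { exact := (ShortComplex.ShortExact.moduleCat_exact_iff_function_exact S).mpr hfg
      mono_f := (ModuleCat.mono_iff_injective _).mpr hf
      epi_g := (ModuleCat.epi_iff_surjective _).mpr hg }
  have := hR (ModuleCat.of R K) hK
  obtain ⟨x, hx⟩ := Abelian.Ext.contravariant_sequence_exact₁ hS (ModuleCat.of R R)
    (Abelian.Ext.mk₀ (𝟙 (ModuleCat.of R R))) (add_zero 1)
    (@Subsingleton.elim (Abelian.Ext.{u} (ModuleCat.of R K) (ModuleCat.of R R) 1) this _ _)
  obtain ⟨h, rfl⟩ := (Abelian.Ext.mk₀_bijective _ _).2 x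
  rw [Abelian.Ext.mk₀_comp_mk₀] at hx
  have hh : S.f ≫ h = 𝟙 _ := (Abelian.Ext.mk₀_bijective _ _).1 hx
  exact ⟨h.hom, fun x => congrArg (fun k => k.hom x) hh⟩

/-- Over a left cotorsion ring every directed compatible system of right coprime pairs has a
lower bound that extends the system. -/
theorem CoprimeSystem.exists_cone {R : Type u} [Ring R] (hR : IsLeftCotorsion R)
    {ι : Type u} [Preorder ι] [IsDirectedOrder ι] [Nonempty ι] (S : CoprimeSystem R ι) :
    ∃ (m : CoprimePair R) (x y : ι → R),
      (∀ i, m.fst = (S.pair i).fst * x i ∧ m.snd = (S.pair i).snd * y i) ∧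
      ∀ i j, i ≤ j → x i = S.r i j * x j ∧ y i = S.s i j * y j := by
  have hle : S.eventuallyZero ≤ S.eventuallyDiagonal := le_sup_left
  -- The exact sequence is R → limit → `Cokernel`, the limit being the compatible functions modulo
  -- the eventually zero ones.
  obtain ⟨h₀, hh₀⟩ := hR.exists_retraction (S.eventuallyZero.mkQ ∘ₗ S.diagonal)
    (Submodule.factor hle)
    ((injective_iff_map_eq_zero _).mpr fun u hu =>
      S.diagonal_mem_eventuallyZero ((Submodule.Quotient.mk_eq_zero _).mp hu))
    (Submodule.factor_surjective hle)
    (by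
      intro z
      obtain ⟨z, rfl⟩ := Submodule.Quotient.mk_surjective _ z
      constructor
      · intro hz
        obtain ⟨w, hw, _, ⟨u, rfl⟩, rfl⟩ :=
          Submodule.mem_sup.mp ((Submodule.Quotient.mk_eq_zero S.eventuallyDiagonal).mp hz)
        refine ⟨u, ?_⟩
        rw [Submodule.Quotient.mk_add, (Submodule.Quotient.mk_eq_zero _).mpr hw, zero_add]
        rfl
      · rintro ⟨u, hu⟩
        rw [← hu]
        exact (Submodule.Quotient.mk_eq_zero S.eventuallyDiagonal).mpr
          (Submodule.mem_sup_right ⟨u, rfl⟩))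
    S.isFlat_cokernel
  set h : S.eventuallyCompatible →ₗ[R] R := h₀ ∘ₗ S.eventuallyZero.mkQ
  have hdiag : ∀ u, h (S.diagonal u) = u := hh₀
  have heq : ∀ (z z' : S.eventuallyCompatible) (i : ι), (∀ j, i ≤ j → z.1 j = z'.1 j) →
      h z = h z' := by
    intro z z' i hi
    refine congrArg h₀ ((Submodule.Quotient.eq _).mpr ⟨i, fun j hj => ?_⟩)
    change z.1 j - z'.1 j = 0
    rw [hi j hj, sub_self]
  have hx : ∀ i j, i ≤ j → h (S.germ i 1 0) = S.r i j * h (S.germ j 1 0) := by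
    intro i j hij
    rw [← smul_eq_mul, ← map_smul]
    refine heq _ _ j fun k hk => ?_
    simp [germ, S.r_trans hij hk]
  have hy : ∀ i j, i ≤ j → h (S.germ i 0 1) = S.s i j * h (S.germ j 0 1) := by
    intro i j hij
    rw [← smul_eq_mul, ← map_smul]
    refine heq _ _ j fun k hk => ?_
    simp [germ, S.s_trans hij hk]
  -- The left side is h of the germ of (a_i, b_i), which eventually agrees with the diagonal of 1.
  have hone : ∀ i, (S.pair i).fst * h (S.germ i 1 0) + (S.pair i).snd * h (S.germ i 0 1) = 1 := by
    intro i
    rw [← smul_eq_mul, ← smul_eq_mul, ← map_smul, ← map_smul, ← map_add]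
    refine (heq _ _ i fun k hk => ?_).trans (hdiag 1)
    simp [germ, diagonal, S.fst_eq hk, S.snd_eq hk]
  -- For i ≤ j, a_i x_i = a_i r_ij x_j = a_j x_j; arbitrary indices are compared through an upper
  -- bound.
  have hconst : ∀ i j, (S.pair i).fst * h (S.germ i 1 0) = (S.pair j).fst * h (S.germ j 1 0) ∧
      (S.pair i).snd * h (S.germ i 0 1) = (S.pair j).snd * h (S.germ j 0 1) := by
    have key : ∀ i j, i ≤ j →
        (S.pair i).fst * h (S.germ i 1 0) = (S.pair j).fst * h (S.germ j 1 0) ∧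
        (S.pair i).snd * h (S.germ i 0 1) = (S.pair j).snd * h (S.germ j 0 1) := fun i j hij => by
      rw [hx i j hij, hy i j hij, S.fst_eq hij, S.snd_eq hij, mul_assoc, mul_assoc]
      exact ⟨rfl, rfl⟩
    intro i j
    obtain ⟨k, hik, hjk⟩ := exists_ge_ge i j
    exact ⟨(key i k hik).1.trans (key j k hjk).1.symm, (key i k hik).2.trans (key j k hjk).2.symm⟩
  exact ⟨CoprimePair.ofAddEqOne _ _ (hone (Classical.arbitrary ι)), fun i => h (S.germ i 1 0),
    fun i => h (S.germ i 0 1), fun i => hconst _ i, fun i j hij => ⟨hx i j hij, hy i j hij⟩⟩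

/-! ### Zorn's lemma for systems of pairs with scalars -/

/-- An element `(p, q, x, y)` is regarded as an arrow from `p` to `q = (p.fst * x, p.snd * y)`.
A compatible set of arrows is a thin category whose objects are linearly preordered. -/
structure IsCompatibleArrows {R : Type u} [Ring R]
    (T : Set (CoprimePair R × CoprimePair R × R × R)) : Prop where
  source : ∀ {p q x y}, (p, q, x, y) ∈ T → (p, p, 1, 1) ∈ T
  target : ∀ {p q x y}, (p, q, x, y) ∈ T → (q, q, 1, 1) ∈ T
  factor : ∀ {p q x y}, (p, q, x, y) ∈ T → q.fst = p.fst * x ∧ q.snd = p.snd * y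
  unique : ∀ {p q x y x' y'}, (p, q, x, y) ∈ T → (p, q, x', y') ∈ T → x = x' ∧ y = y'
  comp : ∀ {p q t x y x' y'}, (p, q, x, y) ∈ T → (q, t, x', y') ∈ T →
    (p, t, x * x', y * y') ∈ T
  total : ∀ {p q}, (p, p, 1, 1) ∈ T → (q, q, 1, 1) ∈ T →
    ∃ x y, (p, q, x, y) ∈ T ∨ (q, p, x, y) ∈ T

/-- The objects of a set of arrows. -/
structure ArrowVertex {R : Type u} [Ring R] (T : Set (CoprimePair R × CoprimePair R × R × R)) :
    Type u where
  val : CoprimePair R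
  mem : (val, val, 1, 1) ∈ T

namespace IsCompatibleArrows

variable {R : Type u} [Ring R]

theorem singleton (p : CoprimePair R) :
    IsCompatibleArrows {(p, p, (1 : R), (1 : R))} := by
  constructor <;> simp only [Set.mem_singleton_iff, Prod.mk.injEq]
  · rintro _ _ _ _ ⟨rfl, -⟩
    simp
  · rintro _ _ _ _ ⟨-, rfl, -⟩
    simp
  · rintro _ _ _ _ ⟨rfl, rfl, rfl, rfl⟩
    simp
  · rintro _ _ _ _ _ _ ⟨-, -, rfl, rfl⟩ ⟨-, -, rfl, rfl⟩
    simp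
  · rintro _ _ _ _ _ _ _ ⟨rfl, -, rfl, rfl⟩ ⟨-, rfl, rfl, rfl⟩
    simp
  · rintro _ _ ⟨rfl, -⟩ ⟨rfl, -⟩
    exact ⟨1, 1, by simp⟩

/-- Each axiom involves at most two given arrows, and these lie in a common member of the chain. -/
theorem sUnion {c : Set (Set (CoprimePair R × CoprimePair R × R × R))}
    (hc : ∀ T ∈ c, IsCompatibleArrows T) (hchain : IsChain (· ⊆ ·) c) :
    IsCompatibleArrows (⋃₀ c) := by
  have pair : ∀ {a b}, a ∈ ⋃₀ c → b ∈ ⋃₀ c → ∃ T ∈ c, a ∈ T ∧ b ∈ T := by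
    rintro a b ⟨T, hT, ha⟩ ⟨T', hT', hb⟩
    rcases hchain.total hT hT' with h | h
    · exact ⟨T', hT', h ha, hb⟩
    · exact ⟨T, hT, ha, h hb⟩
  refine ⟨?_, ?_, ?_, ?_, ?_, ?_⟩
  · rintro p q x y ⟨T, hT, h⟩
    exact ⟨T, hT, (hc T hT).source h⟩
  · rintro p q x y ⟨T, hT, h⟩
    exact ⟨T, hT, (hc T hT).target h⟩
  · rintro p q x y ⟨T, hT, h⟩
    exact (hc T hT).factor h
  · intro p q x y x' y' h h'
    obtain ⟨T, hT, h, h'⟩ := pair h h'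
    exact (hc T hT).unique h h'
  · intro p q t x y x' y' h h'
    obtain ⟨T, hT, h, h'⟩ := pair h h'
    exact ⟨T, hT, (hc T hT).comp h h'⟩
  · intro p q h h'
    obtain ⟨T, hT, h, h'⟩ := pair h h'
    obtain ⟨x, y, hxy⟩ := (hc T hT).total h h'
    exact ⟨x, y, hxy.imp (fun h => ⟨T, hT, h⟩) fun h => ⟨T, hT, h⟩⟩

/-- A cone over a compatible set of arrows whose vertex is a new pair can be adjoined. -/
theorem adjoin {T : Set (CoprimePair R × CoprimePair R × R × R)} (hT : IsCompatibleArrows T)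
    (m : CoprimePair R) (hm : (m, m, 1, 1) ∉ T) (x y : CoprimePair R → R)
    (hfac : ∀ p, (p, p, 1, 1) ∈ T → m.fst = p.fst * x p ∧ m.snd = p.snd * y p)
    (hcomp : ∀ p q a b, (p, q, a, b) ∈ T → x p = a * x q ∧ y p = b * y q) :
    IsCompatibleArrows (T ∪ {(m, m, 1, 1)} ∪
      {t | ∃ p, (p, p, 1, 1) ∈ T ∧ t = (p, m, x p, y p)}) := by
  -- No arrow of T starts or ends at m, which rules out most mixed cases below.
  have hs : ∀ {q a b}, (m, q, a, b) ∉ T := fun h => hm (hT.source h)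
  have ht : ∀ {q a b}, (q, m, a, b) ∉ T := fun h => hm (hT.target h)
  constructor <;> simp only [Set.mem_union, Set.mem_singleton_iff, Prod.mk.injEq, Set.mem_ofPred_eq]
  · rintro p q a b ((h | ⟨rfl, -⟩) | ⟨_, h, rfl, -⟩)
    · exact Or.inl (Or.inl (hT.source h))
    · simp
    · exact Or.inl (Or.inl h)
  · rintro p q a b ((h | ⟨-, rfl, -⟩) | ⟨_, h, -, rfl, -⟩)
    · exact Or.inl (Or.inl (hT.target h))
    · simp
    · simp
  · rintro p q a b ((h | ⟨rfl, rfl, rfl, rfl⟩) | ⟨_, h, rfl, rfl, rfl, rfl⟩)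
    · exact hT.factor h
    · simp
    · exact hfac _ h
  · rintro p q a b a' b' ((h | ⟨rfl, rfl, rfl, rfl⟩) | ⟨_, h, rfl, rfl, rfl, rfl⟩)
      ((h' | ⟨h₁, h₂, rfl, rfl⟩) | ⟨_, h', rfl, h₂, rfl, rfl⟩)
    · exact hT.unique h h'
    · exact (hs (h₁ ▸ h)).elim
    · exact (ht (h₂ ▸ h)).elim
    · exact (hs h').elim
    · exact ⟨rfl, rfl⟩
    · exact (hs h').elim
    · exact (ht h').elim
    · exact (hs (h₁ ▸ h)).elim
    · exact ⟨rfl, rfl⟩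
  · rintro p q t a b a' b' ((h | ⟨rfl, rfl, rfl, rfl⟩) | ⟨_, h, rfl, rfl, rfl, rfl⟩)
      ((h' | ⟨h₁, h₂, rfl, rfl⟩) | ⟨_, h', rfl, rfl, rfl, rfl⟩)
    · exact Or.inl (Or.inl (hT.comp h h'))
    · exact (ht (h₁ ▸ h)).elim
    · obtain ⟨h₁, h₂⟩ := hcomp _ _ _ _ h
      exact Or.inr ⟨p, hT.source h, rfl, rfl, h₁.symm, h₂.symm⟩
    · exact (hs h').elim
    · simp [h₂]
    · exact (hs h').elim
    · exact (hs h').elim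
    · exact Or.inr ⟨p, h, rfl, h₂, by simp⟩
    · exact (hs h').elim
  · rintro p q ((h | ⟨rfl, -⟩) | ⟨_, h, rfl, rfl, -⟩)
      ((h' | ⟨rfl, -⟩) | ⟨_, h', rfl, h₂, -⟩)
    · obtain ⟨a, b, hab⟩ := hT.total h h'
      exact ⟨a, b, hab.imp (fun h => Or.inl (Or.inl h)) fun h => Or.inl (Or.inl h)⟩
    · exact ⟨_, _, Or.inl (Or.inr ⟨p, h, rfl, rfl, rfl, rfl⟩)⟩
    · exact (hm (h₂ ▸ h')).elim
    · exact ⟨_, _, Or.inr (Or.inr ⟨q, h', rfl, rfl, rfl, rfl⟩)⟩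
    · exact ⟨1, 1, by simp⟩
    · exact (hm (h₂ ▸ h')).elim
    · exact (hm h).elim
    · exact (hm h).elim
    · exact (hm h).elim

/-- Over a left cotorsion ring every nonempty compatible set of arrows has a cone. -/
theorem exists_cone (hR : IsLeftCotorsion R)
    {T : Set (CoprimePair R × CoprimePair R × R × R)} (hT : IsCompatibleArrows T)
    {p₀ : CoprimePair R} (hp₀ : (p₀, p₀, 1, 1) ∈ T) :
    ∃ (m : CoprimePair R) (x y : CoprimePair R → R),
      (∀ p, (p, p, 1, 1) ∈ T → m.fst = p.fst * x p ∧ m.snd = p.snd * y p) ∧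
      ∀ p q a b, (p, q, a, b) ∈ T → x p = a * x q ∧ y p = b * y q := by
  classical
  let ι : Type u := ArrowVertex T
  let _ : Preorder ι :=
    { le := fun p q => ∃ z : R × R, (p.1, q.1, z.1, z.2) ∈ T
      le_refl := fun p => ⟨(1, 1), p.mem⟩
      le_trans := fun p q t ⟨z, hz⟩ ⟨w, hw⟩ => ⟨(z.1 * w.1, z.2 * w.2), hT.comp hz hw⟩ }
  have hdir : IsDirectedOrder ι := ⟨fun p q => by
    obtain ⟨a, b, h | h⟩ := hT.total p.mem q.mem
    · exact ⟨q, ⟨(a, b), h⟩, le_rfl⟩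
    · exact ⟨p, le_rfl, ⟨(a, b), h⟩⟩⟩
  have : Nonempty ι := ⟨⟨p₀, hp₀⟩⟩
  have harrow : ∀ p q : ι, ∃ z : R × R, p ≤ q → (p.1, q.1, z.1, z.2) ∈ T := fun p q => by
    by_cases h : p ≤ q
    · exact h.imp fun _ hz _ => hz
    -- Scalars between indices not in order are never used.
    · exact ⟨0, fun h' => (h h').elim⟩
  choose z hz using harrow
  let S : CoprimeSystem R ι :=
    { pair := ArrowVertex.val
      r := fun p q => (z p q).1
      s := fun p q => (z p q).2
      r_self := fun p => (hT.unique (hz p p le_rfl) p.mem).1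
      s_self := fun p => (hT.unique (hz p p le_rfl) p.mem).2
      fst_eq := fun h => (hT.factor (hz _ _ h)).1
      snd_eq := fun h => (hT.factor (hz _ _ h)).2
      r_trans := fun h h' =>
        (hT.unique (hz _ _ (h.trans h')) (hT.comp (hz _ _ h) (hz _ _ h'))).1
      s_trans := fun h h' =>
        (hT.unique (hz _ _ (h.trans h')) (hT.comp (hz _ _ h) (hz _ _ h'))).2 }
  obtain ⟨m, x, y, hm, hxy⟩ := S.exists_cone hR
  refine ⟨m, fun p => if hp : (p, p, 1, 1) ∈ T then x ⟨p, hp⟩ else 0,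
    fun p => if hp : (p, p, 1, 1) ∈ T then y ⟨p, hp⟩ else 0, fun p hp => ?_,
    fun p q a b h => ?_⟩
  · simp only [dif_pos hp]
    exact hm ⟨p, hp⟩
  · have hp := hT.source h
    have hq := hT.target h
    have hpq : (⟨p, hp⟩ : ι) ≤ ⟨q, hq⟩ := ⟨(a, b), h⟩
    simp only [dif_pos hp, dif_pos hq]
    obtain ⟨rfl, rfl⟩ := hT.unique h (hz _ _ hpq)
    exact hxy _ _ hpq

end IsCompatibleArrows

/-- Over a left cotorsion ring every right coprime pair lies above a minimal one. -/
theorem IsLeftCotorsion.exists_isMin_le {R : Type u} [Ring R] (hR : IsLeftCotorsion R)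
    (p₀ : CoprimePair R) : ∃ m ≤ p₀, IsMin m := by
  obtain ⟨T, hT₀, hT⟩ := zorn_subset_nonempty {T | IsCompatibleArrows (R := R) T}
    (fun c hc hchain _ => ⟨⋃₀ c, IsCompatibleArrows.sUnion hc hchain,
      fun _ => Set.subset_sUnion_of_mem⟩) _ (IsCompatibleArrows.singleton p₀)
  have hp₀ : (p₀, p₀, 1, 1) ∈ T := hT₀ rfl
  obtain ⟨m, x, y, hm, hxy⟩ := IsCompatibleArrows.exists_cone hR hT.prop hp₀
  refine ⟨m, CoprimePair.le_iff.mpr ⟨_, _, hm p₀ hp₀⟩, fun m' hm' => ?_⟩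
  obtain ⟨c, d, hc, hd⟩ := CoprimePair.le_iff.mp hm'
  -- If m' is in T, the cone with vertex m gives m ≤ m'. Otherwise the cone composed with (c, d)
  -- adjoins m', contradicting maximality.
  by_cases hmem : (m', m', 1, 1) ∈ T
  · exact CoprimePair.le_iff.mpr ⟨_, _, hm m' hmem⟩
  · refine (hmem (hT.le_of_ge (IsCompatibleArrows.adjoin hT.prop m' hmem (fun p => x p * c)
      (fun p => y p * d) (fun p hp => ?_) fun p q a b h => ?_)
      (Set.subset_union_left.trans Set.subset_union_left) (Or.inl (Or.inr rfl)))).elim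
    · rw [hc, hd, (hm p hp).1, (hm p hp).2, mul_assoc, mul_assoc]
      exact ⟨rfl, rfl⟩
    · rw [(hxy p q a b h).1, (hxy p q a b h).2, mul_assoc, mul_assoc]
      exact ⟨rfl, rfl⟩

/-! ### Lower bounds of compatible chains and the theorem -/

theorem IsCompatibleChain.exists_le {R : Type u} [Ring R] (hR : IsLeftCotorsion R)
    {κ : Ordinal.{u}} {p : Set.Iio κ → RCP R} (hp : IsCompatibleChain p) :
    ∃ m : CoprimePair R, ∀ α, m.cls ≤ p α := by
  classical
  obtain ⟨-, g, r, s, hg, hfac, hcomp⟩ := hp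
  rcases isEmpty_or_nonempty κ.ToType with hκ | hκ
  -- For the empty chain any coprime pair serves.
  · exact ⟨CoprimePair.ofAddEqOne 1 0 (add_zero 1), fun α => hκ.elim (Ordinal.ToType.mk α)⟩
  let e : κ.ToType ≃o Set.Iio κ := Ordinal.ToType.mk.symm
  let S : CoprimeSystem R κ.ToType :=
    { pair := fun i => g (e i)
      -- The chain leaves its scalars unspecified on the diagonal, where the system needs 1.
      r := fun i j => if i = j then 1 else r (e i) (e j)
      s := fun i j => if i = j then 1 else s (e i) (e j)
      r_self := fun i => if_pos rfl
      s_self := fun i => if_pos rfl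
      fst_eq := fun {i j} h => by
        rcases h.eq_or_lt with rfl | h
        · simp
        · rw [if_neg h.ne, (hfac _ _ (e.lt_iff_lt.mpr h)).1]
      snd_eq := fun {i j} h => by
        rcases h.eq_or_lt with rfl | h
        · simp
        · rw [if_neg h.ne, (hfac _ _ (e.lt_iff_lt.mpr h)).2]
      r_trans := fun {i j k} h h' => by
        rcases h.eq_or_lt with rfl | h
        · simp
        rcases h'.eq_or_lt with rfl | h'
        · simp
        rw [if_neg h.ne, if_neg h'.ne, if_neg (h.trans h').ne,
          (hcomp _ _ _ (e.lt_iff_lt.mpr h) (e.lt_iff_lt.mpr h')).1]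
      s_trans := fun {i j k} h h' => by
        rcases h.eq_or_lt with rfl | h
        · simp
        rcases h'.eq_or_lt with rfl | h'
        · simp
        rw [if_neg h.ne, if_neg h'.ne, if_neg (h.trans h').ne,
          (hcomp _ _ _ (e.lt_iff_lt.mpr h) (e.lt_iff_lt.mpr h')).2] }
  obtain ⟨m, x, y, hm, -⟩ := S.exists_cone hR
  refine ⟨m, fun α => ?_⟩
  have h : m ≤ g (e (e.symm α)) := CoprimePair.le_iff.mpr ⟨_, _, hm (e.symm α)⟩
  rw [e.apply_symm_apply] at h
  rw [← hg α]
  exact h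

end CoprimeChain

theorem theoremt (R : Type u) [Ring R] (hR : CoprimeChain.IsLeftCotorsion R) :
    CoprimeChain.IsRightStronglyExchange R := by
  intro κ p hp
  obtain ⟨m, hm⟩ := hp.exists_le hR
  obtain ⟨m', hle, hmin⟩ := hR.exists_isMin_le m
  refine ⟨m'.cls, fun α => le_trans (show m'.cls ≤ m.cls from hle) (hm α), fun q hq => ?_⟩
  induction q using Quotient.inductionOn with
  | _ q => exact hmin hq
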